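/- Let $A$ be an infinite-dimensional simple unital C*-algebra (simple: $A\neq 0$, and the only closed two-sided ideals of $A$ are $0$ and $A$). For a C*-algebra $D$ and positive elements $a,b\in D$ write $a\precsim_D b$ if there is a sequence $(v_n)_{n\ge 1}$ in $D$ with $\lim_{n\to\infty}\|v_n b v_n^*-a\|=0$. Let $B\subset A$ be a centrally large subalgebra, that is, a (norm-closed, self-adjoint) subalgebra containing the unit of $A$ such that for every integer $m\ge 1$, all $a_1,\dots,a_m\in A$, every $\varepsilon>0$, every $x\in A_+$ with $\|x\|=1$, and every $y\in B_+\setminus\{0\}$, there are $c_1,\dots,c_m\in A$ and $g\in B$ such that 1. $0\le g\le 1$; 2. $\|c_j-a_j\|<\varepsilon$ for $j=1,\dots,m$; 3. $(1-g)c_j\in B$ for $j=1,\dots,m$; 4. $g\precsim_B y$ and $g\precsim_A x$; 5. $\|(1-g)x(1-g)\|>1-\varepsilon$; 6. $\|ga_j-a_jg\|<\varepsilon$ for $j=1,\dots,m$. If $B$ has real rank zero, then $A$ has real rank zero. Here a unital C*-algebra $D$ has real rank zero if the set of invertible self-adjoint elements of $D$ is norm dense in the set $D_{sa}$ of all self-adjoint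 elements of $D$. -/

import Mathlib

open Filter Topology

/-- A C⋆-algebra is simple if it is nonzero and its only *closed* two-sided ideals are
`0` and the whole algebra. -/
structure IsSimpleCStar (A : Type*) [CStarAlgebra A] : Prop where
  nontrivial : Nontrivial A
  eq_bot_or_eq_top : ∀ I : TwoSidedIdeal A, IsClosed (I : Set A) → I = ⊥ ∨ I = ⊤

/-- Cuntz subequivalence `a ≾_A b` of positive elements of `A`: some sequence `v` in `A`
satisfies `v n * b * (v n)⋆ → a` in norm. -/
def CuntzSubeq {A : Type*} [NormedRing A] [StarRing A] (a b : A) : Prop :=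
  ∃ v : ℕ → A, Tendsto (fun n => v n * b * star (v n)) atTop (𝓝 a)

/-- Real rank zero of a unital C⋆-algebra: the invertible self-adjoint elements are dense in the
set of self-adjoint elements. -/
def RealRankZero (A : Type*) [NormedRing A] [StarRing A] : Prop :=
  Dense {x : selfAdjoint A | IsUnit (x : A)}

/-- `B` is a centrally large subalgebra of `A`. A `StarSubalgebra` always contains the unit of
`A`; together with closedness this makes `B` a unital C⋆-subalgebra. Elements of `B` are positive
in `B` exactly when they are positive in `A`, so positivity is stated in `A`. The two Cuntz
relations are taken in the algebras `B` and `A` respectively. -/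
structure IsCentrallyLarge {A : Type*} [CStarAlgebra A] [PartialOrder A] [StarOrderedRing A]
    (B : StarSubalgebra ℂ A) : Prop where
  isClosed : IsClosed (B : Set A)
  exists_approx : ∀ (m : ℕ), 0 < m → ∀ (a : Fin m → A) (ε : ℝ), 0 < ε →
    ∀ x : A, 0 ≤ x → ‖x‖ = 1 → ∀ y : B, 0 ≤ (y : A) → y ≠ 0 →
      ∃ (c : Fin m → A) (g : B),
        (0 ≤ (g : A) ∧ (g : A) ≤ 1) ∧
        (∀ j, ‖c j - a j‖ < ε) ∧
        (∀ j, (1 - (g : A)) * c j ∈ B) ∧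
        (CuntzSubeq g y ∧ CuntzSubeq (g : A) x) ∧
        1 - ε < ‖(1 - (g : A)) * x * (1 - (g : A))‖ ∧
        (∀ j, ‖(g : A) * a j - a j * (g : A)‖ < ε)

/-!
The idea is to perturb a self-adjoint `a` to a block matrix whose only block outside `B` is one
that a Schur complement can absorb.

If `a` is not invertible, functional calculus replaces it by a nearby element annihilated by some
`b ≥ 0` of norm `1`. Applying the definition of a centrally large subalgebra with `x = b` gives
`g` such that `(1 - g) * b * (1 - g)` is nearly in `B`, has norm near `1`, and nearly annihilates
`a`, since `g` nearly commutes with `a`. As `B` has real rank zero, a spectral projection of this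
element is a nonzero projection `q` of `B` with `q * a` small
(`IsCentrallyLarge.exists_projection_norm_mul_lt`), so one may assume `q * a = 0`.

A second application, now with `y = q`, gives `g` that is Cuntz below `q` and such that `(1 - g) * a`
is nearly in `B`. Let `e` be a spectral projection in `B` of `(1 - q) * g * (1 - q)` and
`r = 1 - q - e`. On `r` the element `g` is small, so `r * a * r` is nearly in `B`, and it is near
an invertible element of the corner `r * B * r` because real rank zero passes to corners
(`RealRankZero.exists_isCornerInverse`). On `e` the element `g` is bounded below, so Cuntz
subequivalence gives `z` in `e * A * q` with `z * star z` bounded below in the corner of `e`.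

Nothing is known about `e * a * e`, but adding `κ • q + τ • (z + star z)` to the matrix adds
`-(τ ^ 2 / κ) • (z * star z)` to the Schur complement on `e`, and for `κ` small this outweighs every
other term. Hence the perturbed matrix is invertible (`exists_isUnit_near_of_corner`).
-/

/-! ### Corners and Schur complements -/

/-- `n` is the inverse of `k` in the corner `p * R * p`, whose unit is `p`. -/
structure IsCornerInverse {R : Type*} [Ring R] (p k n : R) : Prop where
  left_mul : p * k = k
  mul_right : k * p = k
  left_mul_inv : p * n = n
  inv_mul_right : n * p = n
  mul_inv : k * n = p
  inv_mul : n * k = p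

section Schur

variable {R : Type*} [Ring R]

/-- An element is invertible exactly when its Schur complement, completed by the invertible corner
block `N`, is: the two differ by unipotent triangular factors. -/
theorem isUnit_iff_isUnit_schur {e M n : R} (he : e * e = e)
    (hn : IsCornerInverse (1 - e) ((1 - e) * M * (1 - e)) n) :
    IsUnit M ↔ IsUnit ((1 - e) * M * (1 - e) +
      (e * M * e - e * M * (1 - e) * n * ((1 - e) * M * e))) := by
  set N := (1 - e) * M * (1 - e) with hN
  set Y := (1 - e) * M * e with hY
  set X := e * M * (1 - e) with hX
  have hne : n * e = 0 := by
    rw [← hn.inv_mul_right, mul_assoc, sub_mul, he]; simp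
  have hen : e * n = 0 := by
    rw [← hn.left_mul_inv, ← mul_assoc, mul_sub, he]; simp
  have hYe : Y * e = Y := by rw [hY, mul_assoc, he]
  have heX : e * X = X := by rw [hX, ← mul_assoc, ← mul_assoc, he]
  have hYn : Y * n = 0 := by rw [← hYe, mul_assoc, hen, mul_zero]
  have hnX : n * X = 0 := by rw [← heX, ← mul_assoc, hne, zero_mul]
  have hNnY : N * (n * Y) = Y := by
    rw [← mul_assoc, hn.mul_inv, hY, ← mul_assoc, ← mul_assoc]
    congr 2
    simp [mul_sub, sub_mul, he]
  have hXnN : X * n * N = X := by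
    rw [mul_assoc, hn.inv_mul, hX, mul_assoc]
    congr 1
    simp [mul_sub, sub_mul, he]
  have hU : IsUnit (1 + n * Y) := by
    refine ⟨⟨1 + n * Y, 1 - n * Y, ?_, ?_⟩, rfl⟩
    · have : n * Y * (n * Y) = 0 := by
        rw [mul_assoc, ← mul_assoc Y, hYn]; simp
      simp [mul_sub, add_mul, this]
    · have : n * Y * (n * Y) = 0 := by
        rw [mul_assoc, ← mul_assoc Y, hYn]; simp
      simp [mul_add, sub_mul, this]
  have hL : IsUnit (1 + X * n) := by
    have : X * n * (X * n) = 0 := by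
      rw [mul_assoc, ← mul_assoc n, hnX]; simp
    refine ⟨⟨1 + X * n, 1 - X * n, ?_, ?_⟩, rfl⟩
    · simp [mul_sub, add_mul, this]
    · simp [mul_add, sub_mul, this]
  have hfac : (1 + X * n) * (N + (e * M * e - X * n * Y)) * (1 + n * Y) = M := by
    have h1 : (e * M * e - X * n * Y) * (n * Y) = 0 := by
      rw [sub_mul, mul_assoc (e * M), ← mul_assoc e n, hen, mul_assoc (X * n),
        ← mul_assoc Y, hYn]
      simp
    have h2 : X * n * (e * M * e - X * n * Y) = 0 := by
      rw [mul_sub, mul_assoc X, mul_assoc e, ← mul_assoc n, hne, mul_assoc X n Y, mul_assoc X,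
        ← mul_assoc n, hnX]
      simp
    have h3 : N + X + Y + e * M * e = M := by
      rw [hN, hX, hY]; noncomm_ring
    have h4 : (1 + X * n) * (N + (e * M * e - X * n * Y)) = N + (e * M * e - X * n * Y) + X := by
      rw [add_mul, one_mul, mul_add, hXnN, h2, add_zero]
    rw [h4, mul_add, mul_one, add_mul, add_mul, hNnY, h1, ← mul_assoc X n Y]
    refine Eq.trans ?_ h3
    abel
  obtain ⟨u, hu⟩ := hU
  obtain ⟨l, hl⟩ := hL
  conv_lhs => rw [← hfac]
  rw [← hu, ← hl, Units.isUnit_mul_units, Units.isUnit_units_mul]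

/-- A summand of a block diagonal invertible element is invertible in its corner. -/
theorem exists_isCornerInverse_of_isUnit_add {e N S : R} (he : e * e = e) (heN : e * N = 0)
    (hNe : N * e = 0) (heS : e * S = S) (hSe : S * e = S) (h : IsUnit (N + S)) :
    ∃ s, IsCornerInverse e S s := by
  obtain ⟨m, h1, h2⟩ := isUnit_iff_exists.mp h
  have hmS : m * S = e := by
    have := congrArg (· * e) h2
    simpa [mul_assoc, add_mul, hNe, hSe] using this
  have hSm : S * m = e := by
    have := congrArg (e * ·) h1
    simpa [← mul_assoc, mul_add, heN, heS] using this
  have hc : e * m = m * e := by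
    rw [← hSm, ← mul_assoc, hmS, hSm]
  refine ⟨e * m, heS, hSe, ?_, ?_, ?_, ?_⟩
  · rw [← mul_assoc, he]
  · rw [mul_assoc, ← hc, ← mul_assoc, he]
  · rw [← mul_assoc, hSe, hSm]
  · rw [mul_assoc, hmS, he]

/-- Invertibility of the block diagonal element `N + S`, where `S` lives in the complementary corner
and its invertibility there is expressed by completing it with the unit `p` of the other one. -/
theorem IsCornerInverse.isUnit_add {p N S n : R} (hp : p * p = p) (hn : IsCornerInverse p N n)
    (hpS : p * S = 0) (hS : IsUnit (p + S)) : IsUnit (N + S) := by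
  have hU : IsUnit (N + (1 - p)) := by
    refine isUnit_iff_exists.mpr ⟨n + (1 - p), ?_, ?_⟩
    · simp only [mul_add, add_mul, mul_sub, sub_mul, one_mul, mul_one, hn.mul_inv, hn.mul_right,
        hn.left_mul_inv, hp]
      abel
    · simp only [mul_add, add_mul, mul_sub, sub_mul, one_mul, mul_one, hn.inv_mul,
        hn.inv_mul_right, hn.left_mul, hp]
      abel
  have : N + S = (N + (1 - p)) * (p + S) := by
    have hNS : N * S = 0 := by rw [← hn.mul_right, mul_assoc, hpS, mul_zero]
    simp only [mul_add, add_mul, sub_mul, one_mul, hn.mul_right, hp, hNS, hpS]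
    abel
  rw [this]
  exact hU.mul hS

end Schur

section CornerApprox

variable {D : Type*} [CStarAlgebra D]

theorem IsCornerInverse.isSelfAdjoint {p k n : D} (h : IsCornerInverse p k n)
    (hp : IsSelfAdjoint p) (hk : IsSelfAdjoint k) : IsSelfAdjoint n := by
  have h1 : star n * k = p := by
    have := congrArg star h.mul_inv
    simpa [hk.star_eq, hp.star_eq] using this
  have h2 : star n * p = star n := by
    have := congrArg star h.left_mul_inv
    simpa [hp.star_eq] using this
  rw [IsSelfAdjoint, ← h2, ← h.mul_inv, ← mul_assoc, h1, h.left_mul_inv]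

theorem CStarAlgebra.norm_one_le_one : ‖(1 : D)‖ ≤ 1 := (IsStarProjection.one D).norm_le

theorem RealRankZero.exists_isUnit (hD : RealRankZero D) {d : D} (hd : IsSelfAdjoint d) {ε : ℝ}
    (hε : 0 < ε) : ∃ k : D, IsSelfAdjoint k ∧ IsUnit k ∧ ‖k - d‖ < ε := by
  obtain ⟨k, hk, hk'⟩ := Metric.dense_iff.mp hD ⟨d, hd⟩ ε hε
  refine ⟨k, k.2, hk', ?_⟩
  have : dist k ⟨d, hd⟩ < ε := hk
  simpa [Subtype.dist_eq, dist_eq_norm] using this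

/-- Real rank zero passes to the corner `p * D * p`. The Schur complement of the `1 - p` corner in
an invertible approximant of `d + (1 - p)` is invertible in the corner, and it is close to `d`
because the off-diagonal entries are small. -/
theorem RealRankZero.exists_isCornerInverse (hD : RealRankZero D) {p d : D}
    (hp : IsStarProjection p) (hd : IsSelfAdjoint d) (hpd : p * d = d) {ε : ℝ} (hε : 0 < ε) :
    ∃ k n : D, IsSelfAdjoint k ∧ IsCornerInverse p k n ∧ ‖k - d‖ < ε := by
  have hdp : d * p = d := by
    have := congrArg star hpd
    simpa [hp.isSelfAdjoint.star_eq, hd.star_eq] using this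
  have hpp : p * p = p := hp.isIdempotentElem
  obtain ⟨η, hη, hη2, hηε⟩ : ∃ η : ℝ, 0 < η ∧ η ≤ 1 / 2 ∧ 2 * η ≤ ε :=
    ⟨min (1 / 2) (ε / 2), by positivity, min_le_left _ _, by linarith [min_le_right (1 / 2) (ε / 2)]⟩
  have hq := hp.one_sub
  set q := 1 - p with hqdef
  have hqq : q * q = q := hq.isIdempotentElem
  have hpq : p * q = 0 := hp.mul_one_sub_self
  have hqp : q * p = 0 := hp.one_sub_mul_self
  obtain ⟨M, hM, hMu, hMd⟩ := hD.exists_isUnit (hd.add hq.isSelfAdjoint) hη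
  have hnp := hp.norm_le
  have hnq := hq.norm_le
  set E := M - (d + q) with hE
  have hME : M = d + q + E := by rw [hE]; abel
  have hqd : q * d = 0 := by rw [← hpd, ← mul_assoc, hqp, zero_mul]
  have hdq : d * q = 0 := by rw [← hdp, mul_assoc, hpq, mul_zero]
  have bound : ∀ x y : D, ‖x‖ ≤ 1 → ‖y‖ ≤ 1 → ‖x * E * y‖ ≤ ‖E‖ := fun x y hx hy =>
    calc ‖x * E * y‖ ≤ ‖x‖ * ‖E‖ * ‖y‖ := norm_mul₃_le
      _ ≤ 1 * ‖E‖ * 1 := by gcongr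
      _ = ‖E‖ := by ring
  -- The `1 - p` corner of `M` is close to its unit, hence invertible there by a Neumann series.
  have ht : ‖-(q * E * q)‖ < 1 := by
    rw [norm_neg]; linarith [bound q q hnq hnq]
  obtain ⟨u, hu⟩ := isUnit_one_sub_of_norm_lt_one ht
  have hN : q * M * q = q + q * E * q := by
    rw [hME]; simp only [mul_add, add_mul, hqd, hqq, zero_add]
  have huN : (u : D) = p + q * M * q := by
    rw [hu, hN, hqdef]; abel
  have hqu : q * u = q * M * q := by
    rw [huN, mul_add, hqp, zero_add, ← mul_assoc, ← mul_assoc, hqq]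
  have huq : u * q = q * M * q := by
    rw [huN, add_mul, hpq, zero_add, mul_assoc _ q q, hqq]
  have hcomm : q * ↑u⁻¹ = ↑u⁻¹ * q := by
    rw [Units.mul_inv_eq_iff_eq_mul, mul_assoc, hqu, ← huq, Units.inv_mul_cancel_left]
  have hn : IsCornerInverse q (q * M * q) (q * ↑u⁻¹) := by
    refine ⟨?_, ?_, ?_, ?_, ?_, ?_⟩
    · rw [← mul_assoc, ← mul_assoc, hqq]
    · rw [mul_assoc _ q q, hqq]
    · rw [← mul_assoc, hqq]
    · rw [mul_assoc, ← hcomm, ← mul_assoc, hqq]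
    · rw [← huq, mul_assoc, ← mul_assoc q, hqq, hcomm, ← mul_assoc, Units.mul_inv, one_mul]
    · rw [← hqu, hcomm, mul_assoc, ← mul_assoc q, hqq, hqu, ← huq, ← mul_assoc, Units.inv_mul,
        one_mul]
  have hnu : ‖q * (↑u⁻¹ : D)‖ ≤ 2 := by
    have h1 : (↑u⁻¹ : D) = 1 - q * E * q * ↑u⁻¹ := by
      have : (1 - -(q * E * q)) * (↑u⁻¹ : D) = 1 := by rw [← hu, Units.mul_inv]
      rw [sub_mul, one_mul, neg_mul, sub_neg_eq_add] at this
      rw [eq_sub_iff_add_eq, this]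
    have h2 : ‖(↑u⁻¹ : D)‖ ≤ 1 + 1 / 2 * ‖(↑u⁻¹ : D)‖ := by
      calc ‖(↑u⁻¹ : D)‖ = ‖1 - q * E * q * ↑u⁻¹‖ := by rw [← h1]
        _ ≤ ‖(1 : D)‖ + ‖q * E * q * ↑u⁻¹‖ := norm_sub_le _ _
        _ ≤ ‖(1 : D)‖ + ‖q * E * q‖ * ‖(↑u⁻¹ : D)‖ := by gcongr; exact norm_mul_le _ _
        _ ≤ 1 + 1 / 2 * ‖(↑u⁻¹ : D)‖ := by
          gcongr
          · exact CStarAlgebra.norm_one_le_one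
          · linarith [bound q q hnq hnq]
    calc ‖q * (↑u⁻¹ : D)‖ ≤ ‖q‖ * ‖(↑u⁻¹ : D)‖ := norm_mul_le _ _
      _ ≤ 1 * 2 := by gcongr; linarith
      _ = 2 := by norm_num
  set n : D := q * ↑u⁻¹ with hndef
  have hnsa : IsSelfAdjoint n :=
    hn.isSelfAdjoint hq.isSelfAdjoint (by
      have := hM.conjugate q
      rwa [hq.isSelfAdjoint.star_eq] at this)
  have hS := (isUnit_iff_isUnit_schur (M := M) hpp hn).mp hMu
  have hpM : p * M * q = p * E * q := by
    rw [hME]; simp only [mul_add, add_mul, hpd, hpq, hdq, zero_mul, zero_add]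
  have hMp : q * M * p = q * E * p := by
    rw [hME]; simp only [mul_add, add_mul, hqd, hqp, hqq, zero_add]
  have hpMp : p * M * p = d + p * E * p := by
    rw [hME]; simp only [mul_add, add_mul, hpd, hdp, hpq, add_zero]
  rw [← hqdef] at hS
  obtain ⟨s, hs⟩ := exists_isCornerInverse_of_isUnit_add hpp (N := q * M * q)
    (S := p * M * p - p * M * q * n * (q * M * p))
    (by rw [← mul_assoc, ← mul_assoc, hpq]; simp) (by rw [mul_assoc, hqp, mul_zero])
    (by simp only [mul_sub, ← mul_assoc, hpp]) (by simp only [sub_mul, mul_assoc, hpp]) hS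
  refine ⟨_, s, ?_, hs, ?_⟩
  · rw [IsSelfAdjoint]
    simp only [star_sub, star_mul, hp.isSelfAdjoint.star_eq, hq.isSelfAdjoint.star_eq, hM.star_eq,
      hnsa.star_eq, mul_assoc]
  · rw [hpMp, hpM, hMp]
    have h3 : ‖p * E * q * n * (q * E * p)‖ ≤ ‖E‖ * 2 * ‖E‖ := by
      refine norm_mul₃_le.trans ?_
      gcongr
      · exact bound p q hnp hnq
      · exact bound q p hnq hnp
    have h4 : ‖E‖ * 2 * ‖E‖ ≤ ‖E‖ := by nlinarith [norm_nonneg E]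
    calc ‖d + p * E * p - p * E * q * n * (q * E * p) - d‖
        = ‖p * E * p - p * E * q * n * (q * E * p)‖ := by congr 1; abel
      _ ≤ ‖p * E * p‖ + ‖p * E * q * n * (q * E * p)‖ := norm_sub_le _ _
      _ < ε := by linarith [bound p p hnp hnp]

theorem RealRankZero.exists_corner_mem {B : StarSubalgebra ℂ D}
    (hB : IsClosed (B : Set D)) (hRR : RealRankZero B) {p d : D} (hp : IsStarProjection p)
    (hpB : p ∈ B) (hd : IsSelfAdjoint d) (hdB : d ∈ B) (hpd : p * d = d) {t : ℝ} (ht : 0 < t) :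
    ∃ k n : D, k ∈ B ∧ IsSelfAdjoint k ∧ IsCornerInverse p k n ∧ ‖k - d‖ < t := by
  have := hB
  obtain ⟨k, n, hk, hn, hkd⟩ := RealRankZero.exists_isCornerInverse (D := B) hRR
    (p := ⟨p, hpB⟩) (d := ⟨d, hdB⟩) ⟨Subtype.ext hp.isIdempotentElem, Subtype.ext hp.isSelfAdjoint⟩
    (Subtype.ext hd) (Subtype.ext hpd) ht
  exact ⟨k, n, k.2, congrArg Subtype.val hk, ⟨congrArg Subtype.val hn.left_mul,
    congrArg Subtype.val hn.mul_right, congrArg Subtype.val hn.left_mul_inv,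
    congrArg Subtype.val hn.inv_mul_right, congrArg Subtype.val hn.mul_inv,
    congrArg Subtype.val hn.inv_mul⟩, hkd⟩

end CornerApprox

/-! ### Order estimates and spectral projections -/

section Order

variable {A : Type*} [CStarAlgebra A] [PartialOrder A] [StarOrderedRing A]

theorem IsSelfAdjoint.le_add_smul_one {x y : A} (hx : IsSelfAdjoint x) (hy : IsSelfAdjoint y)
    {t : ℝ} (h : ‖x - y‖ ≤ t) : x ≤ y + t • (1 : A) := by
  have h1 := (hx.sub hy).le_algebraMap_norm_self
  have h2 : algebraMap ℝ A ‖x - y‖ ≤ algebraMap ℝ A t := by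
    gcongr
  rw [← sub_le_iff_le_add', ← Algebra.algebraMap_eq_smul_one]
  exact h1.trans h2

theorem IsStarProjection.conj_le_conj_add_smul {e x y : A} (he : IsStarProjection e)
    (hx : IsSelfAdjoint x) (hy : IsSelfAdjoint y) {t : ℝ} (h : ‖x - y‖ ≤ t) :
    e * x * e ≤ e * y * e + t • e := by
  have := he.isSelfAdjoint.conjugate_le_conjugate (hx.le_add_smul_one hy h)
  rwa [mul_add, add_mul, mul_smul_comm, smul_mul_assoc, mul_one, he.isIdempotentElem.eq] at this

theorem IsStarProjection.norm_conj_le {e x : A} (he : IsStarProjection e) (hx : 0 ≤ x) {c : ℝ}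
    (hc : 0 ≤ c) (h : e * x * e ≤ c • e) : ‖e * x * e‖ ≤ c := by
  have h0 : 0 ≤ e * x * e := he.isSelfAdjoint.conjugate_nonneg hx
  calc ‖e * x * e‖ ≤ ‖c • e‖ := CStarAlgebra.norm_le_norm_of_nonneg_of_le h0 h
    _ = c * ‖e‖ := by rw [norm_smul, Real.norm_of_nonneg hc]
    _ ≤ c := mul_le_of_le_one_right hc he.norm_le

/-- The positive spectral projection of a self-adjoint element `k` invertible in the corner
`p * A * p`: the spectrum of `k` in the corner omits `0`, so the indicator function of the positive
half-line is continuous on it, and the projection lies in any closed subalgebra containing `k`. -/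
theorem IsCornerInverse.exists_positive_projection {B : StarSubalgebra ℂ A}
    (hB : IsClosed (B : Set A)) {p k n : A} (hp : IsStarProjection p) (hpB : p ∈ B)
    (hk : IsSelfAdjoint k) (hkB : k ∈ B) (hn : IsCornerInverse p k n) :
    ∃ e ∈ B, IsStarProjection e ∧ p * e = e ∧ e * p = e ∧ e * k = k * e ∧ 0 ≤ e * k ∧
      (p - e) * k ≤ 0 := by
  -- `K` is invertible in `A`, and adding `-(1 - p)` contributes nothing to its positive part.
  set K := k - (1 - p) with hK
  have hKsa : IsSelfAdjoint K := hk.sub hp.one_sub.isSelfAdjoint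
  have hpp : p * p = p := hp.isIdempotentElem
  have hKB : K ∈ B := B.sub_mem hkB (B.sub_mem B.one_mem hpB)
  have hKu : IsUnit K := by
    have : K = k + (p - 1) := by rw [hK]; abel
    rw [this]
    refine hn.isUnit_add hpp (by rw [mul_sub, hpp, mul_one, sub_self]) ?_
    refine isUnit_iff_exists.mpr ⟨p + (p - 1), ?_, ?_⟩ <;>
    · simp only [mul_add, add_mul, mul_sub, sub_mul, one_mul, mul_one, hpp]
      abel
  have h0 : ∀ x ∈ spectrum ℝ K, x ≠ 0 := fun x hx h => by
    rw [h] at hx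
    exact (spectrum.zero_notMem_iff ℝ).mpr hKu hx
  set f : ℝ → ℝ := fun x => if 0 < x then 1 else 0 with hf
  have hfc : ContinuousOn f (spectrum ℝ K) := by
    intro x hx
    refine ContinuousAt.continuousWithinAt ?_
    rcases lt_or_gt_of_ne (h0 x hx) with h | h
    · refine (continuousAt_const (y := (0 : ℝ))).congr ?_
      filter_upwards [Iio_mem_nhds h] with y hy
      simp [hf, not_lt.mpr (le_of_lt (Set.mem_Iio.mp hy))]
    · refine (continuousAt_const (y := (1 : ℝ))).congr ?_
      filter_upwards [Ioi_mem_nhds h] with y hy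
      simp [hf, Set.mem_Ioi.mp hy]
  set e := cfc f K with he
  have heB : e ∈ B := cfc_mem (𝕜' := ℂ) (hs := hB) f hKB
  have hesa : IsSelfAdjoint e := cfc_predicate f K
  have hee : e * e = e := by
    rw [he, ← cfc_mul f f K hfc hfc]
    congr 1
    funext x
    by_cases hx : 0 < x <;> simp [hf, hx]
  have hep : IsStarProjection e := ⟨hee, hesa⟩
  have hKid : cfc (fun x : ℝ => x) K = K := cfc_id' ℝ K
  have heK : e * K = cfc (fun x => f x * x) K := by
    rw [cfc_mul f (fun x => x) K hfc continuousOn_id, hKid]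
  have hKe : e * K = K * e := by
    rw [heK, ← hKid, he, ← cfc_mul (fun x => x) f K continuousOn_id hfc, hKid]
    simp only [mul_comm]
  have heK0 : 0 ≤ e * K := by
    rw [heK]
    refine cfc_nonneg fun x _ => ?_
    by_cases hx : 0 < x <;> simp [hf, hx, le_of_lt]
  have h1eK : (1 - e) * K ≤ 0 := by
    have : (1 - e) * K = cfc (fun x => x - f x * x) K := by
      rw [cfc_sub (fun x => x) (fun x => f x * x) K continuousOn_id (hfc.mul continuousOn_id),
        ← heK, hKid, sub_mul, one_mul]
    rw [this]
    refine cfc_nonpos _ _ fun x _ => ?_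
    by_cases hx : 0 < x
    · simp [hf, hx]
    · simpa [hf, hx] using not_lt.mp hx
  have hKq : K * (1 - p) = -(1 - p) := by
    rw [hK, sub_mul, mul_sub, mul_one, hn.mul_right, hp.one_sub.isIdempotentElem.eq]
    simp
  have hKp : K * p = k := by
    rw [hK, sub_mul, hn.mul_right, hp.one_sub_mul_self, sub_zero]
  have hpe' : e * (1 - p) = 0 := by
    have h1 : 0 ≤ (1 - p) * (e * K) * (1 - p) :=
      hp.one_sub.isSelfAdjoint.conjugate_nonneg heK0
    rw [mul_assoc, mul_assoc, hKq, mul_neg, mul_neg, Left.nonneg_neg_iff, ← mul_assoc] at h1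
    have h2 : 0 ≤ (1 - p) * e * (1 - p) :=
      hp.one_sub.isSelfAdjoint.conjugate_nonneg hep.nonneg
    have h3 : star (e * (1 - p)) * (e * (1 - p)) = 0 := by
      rw [star_mul, hesa.star_eq, hp.one_sub.isSelfAdjoint.star_eq, mul_assoc, ← mul_assoc e, hee,
        ← mul_assoc]
      exact le_antisymm h1 h2
    exact CStarRing.star_mul_self_eq_zero_iff _ |>.mp h3
  have hep' : e * p = e := by
    rw [mul_sub, mul_one, sub_eq_zero] at hpe'
    exact hpe'.symm
  have hpe : p * e = e := by
    have := congrArg star hep'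
    simpa [hesa.star_eq, hp.isSelfAdjoint.star_eq] using this
  have hek : e * k = e * K := by
    rw [hK, mul_sub, hpe', sub_zero]
  refine ⟨e, heB, hep, hpe, hep', ?_, hek ▸ heK0, ?_⟩
  · have hqe : (1 - p) * e = 0 := by rw [sub_mul, hpe, one_mul, sub_self]
    rw [hek, hKe, hK, sub_mul, hqe, sub_zero]
  · have h := hp.isSelfAdjoint.conjugate_le_conjugate h1eK
    have : p * ((1 - e) * K) * p = (p - e) * k := by
      rw [mul_assoc, mul_assoc, hKp, ← mul_assoc, mul_sub, mul_one, hpe]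
    rwa [this, mul_zero, zero_mul] at h

/-- In a closed subalgebra of real rank zero, the spectral projection of `h` above the level `c`
exists up to an arbitrarily small error: `k` stands for `h - c • p` and `e` is its positive spectral
projection. -/
theorem RealRankZero.exists_spectral_projection {B : StarSubalgebra ℂ A}
    (hB : IsClosed (B : Set A)) (hRR : RealRankZero B) {p h : A} (hp : IsStarProjection p)
    (hpB : p ∈ B) (hh : IsSelfAdjoint h) (hhB : h ∈ B) (hph : p * h = h) (c : ℝ) {t : ℝ}
    (ht : 0 < t) :
    ∃ e ∈ B, ∃ k ∈ B, IsStarProjection e ∧ p * e = e ∧ e * p = e ∧ IsSelfAdjoint k ∧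
      ‖k - (h - c • p)‖ < t ∧ p * k = k ∧ k * p = k ∧ e * k = k * e ∧ 0 ≤ e * k ∧
      (p - e) * k ≤ 0 := by
  obtain ⟨k, n, hkB, hk, hn, hkd⟩ := hRR.exists_corner_mem hB hp hpB (d := h - c • p)
    (hh.sub ((IsSelfAdjoint.all c).smul hp.isSelfAdjoint))
    (B.sub_mem hhB (by simpa using B.smul_mem hpB (c : ℂ)))
    (by rw [mul_sub, hph, mul_smul_comm, hp.isIdempotentElem.eq]) ht
  obtain ⟨e, heB, he, h1, h2, h3, h4, h5⟩ := hn.exists_positive_projection hB hp hpB hk hkB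
  exact ⟨e, heB, k, hkB, he, h1, h2, hk, hkd, hn.left_mul, hn.mul_right, h3, h4, h5⟩

end Order

section Approx

variable {A : Type*} [CStarAlgebra A] [PartialOrder A] [StarOrderedRing A]

/-! ### Invertible perturbations -/

/-- Suppose `1 = e + r + q` with orthogonal projections, and `a` vanishes on `q`. If the `r` corner
of `a` is near an invertible element `d` of that corner and some `z` in `e * A * q` has `z * star z`
bounded below in the corner of `e`, then `a` is near an invertible self-adjoint element.

The perturbation is `κ • q` on the diagonal and `τ • (z + star z)` off it. The Schur complement in
the corner of `e` is then a fixed self-adjoint element minus `(τ ^ 2 / κ) • (z * star z)`, which is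
negative and invertible once `κ` is small compared with `τ ^ 2`. -/
theorem exists_isUnit_near_of_corner {e r q a d n z : A} (he : IsStarProjection e)
    (hr : IsStarProjection r) (hq : IsStarProjection q) (hsum : 1 - e = r + q) (her : e * r = 0)
    (heq : e * q = 0) (hrq : r * q = 0) (ha : IsSelfAdjoint a) (hqa : q * a = 0)
    (hd : IsSelfAdjoint d) (hn : IsCornerInverse r d n) (hez : e * z = z) (hzq : z * q = z)
    {l : ℝ} (hl : 0 < l) (hz : l • e ≤ z * star z) {ε : ℝ} (hε : 0 < ε) :
    ∃ M : A, IsSelfAdjoint M ∧ IsUnit M ∧ ‖M - a‖ ≤ ‖d - r * a * r‖ + ε := by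
  have flip : ∀ {x y w : A}, x * y = w → star y * star x = star w := fun h => by
    rw [← h, star_mul]
  have sx := he.isSelfAdjoint.star_eq
  have sr := hr.isSelfAdjoint.star_eq
  have sq := hq.isSelfAdjoint.star_eq
  have sa := ha.star_eq
  have ee : e * e = e := he.isIdempotentElem
  have rr : r * r = r := hr.isIdempotentElem
  have qq : q * q = q := hq.isIdempotentElem
  have hre : r * e = 0 := by simpa [sx, sr] using flip her
  have hqe : q * e = 0 := by simpa [sx, sq] using flip heq
  have hqr : q * r = 0 := by simpa [sr, sq] using flip hrq
  have haq : a * q = 0 := by simpa [sa, sq] using flip hqa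
  have hde : d * e = 0 := by rw [← hn.mul_right, mul_assoc, hre, mul_zero]
  have hed : e * d = 0 := by rw [← hn.left_mul, ← mul_assoc, her, zero_mul]
  have hdq : d * q = 0 := by rw [← hn.mul_right, mul_assoc, hrq, mul_zero]
  have hqd : q * d = 0 := by rw [← hn.left_mul, ← mul_assoc, hqr, zero_mul]
  have hnq : n * q = 0 := by rw [← hn.inv_mul_right, mul_assoc, hrq, mul_zero]
  have hqn : q * n = 0 := by rw [← hn.left_mul_inv, ← mul_assoc, hqr, zero_mul]
  have hnsa : star n = n := (hn.isSelfAdjoint hr.isSelfAdjoint hd).star_eq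
  obtain ⟨τ, hτ, hτz⟩ : ∃ τ : ℝ, 0 < τ ∧ τ * (‖z‖ + ‖z‖) ≤ ε / 2 := by
    refine ⟨ε / (4 * (‖z‖ + 1)), by positivity, ?_⟩
    rw [div_mul_eq_mul_div, div_le_div_iff₀ (by positivity) (by positivity)]
    nlinarith [norm_nonneg z]
  set w := e * a * e - e * a * r * n * (r * a * e) with hw
  have hwsa : IsSelfAdjoint w := by
    rw [IsSelfAdjoint, hw]
    simp only [star_sub, star_mul, sx, sr, sa, hnsa, mul_assoc]
  have hew : e * w * e = w := by
    rw [hw]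
    simp only [mul_sub, sub_mul, mul_assoc, ee]
    simp only [← mul_assoc, ee]
  obtain ⟨κ, hκ, hκε, hκw⟩ : ∃ κ : ℝ, 0 < κ ∧ κ ≤ ε / 2 ∧ ‖w‖ + 1 ≤ κ⁻¹ * τ ^ 2 * l := by
    have hpos : 0 < τ ^ 2 * l / (‖w‖ + 1) := by positivity
    refine ⟨min (ε / 2) (τ ^ 2 * l / (‖w‖ + 1)), by positivity, min_le_left _ _, ?_⟩
    rw [mul_assoc, inv_mul_eq_div, le_div_iff₀ (by positivity)]
    calc (‖w‖ + 1) * min (ε / 2) (τ ^ 2 * l / (‖w‖ + 1))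
        ≤ (‖w‖ + 1) * (τ ^ 2 * l / (‖w‖ + 1)) := by gcongr; exact min_le_right _ _
      _ = τ ^ 2 * l := by field_simp
  -- Rescaled perturbation terms, so that the identities below take place in a ring.
  set Z := τ • z with hZ
  set Q := κ • q with hQ
  set Q' := κ⁻¹ • q with hQ'
  have heZ : e * Z = Z := by rw [hZ, mul_smul_comm, hez]
  have hZq : Z * q = Z := by rw [hZ, smul_mul_assoc, hzq]
  have hze : star Z * e = star Z := by simpa [sx] using flip heZ
  have hqz : q * star Z = star Z := by simpa [sq] using flip hZq
  have hez' : e * star Z = 0 := by rw [← hqz, ← mul_assoc, heq, zero_mul]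
  have hrz' : r * star Z = 0 := by rw [← hqz, ← mul_assoc, hrq, zero_mul]
  have hrz : r * Z = 0 := by rw [← heZ, ← mul_assoc, hre, zero_mul]
  have hqz' : q * Z = 0 := by rw [← heZ, ← mul_assoc, hqe, zero_mul]
  have hzr : Z * r = 0 := by rw [← hZq, mul_assoc, hqr, mul_zero]
  have hze' : Z * e = 0 := by rw [← hZq, mul_assoc, hqe, mul_zero]
  have hzr' : star Z * r = 0 := by rw [← hze, mul_assoc, her, mul_zero]
  have hzq' : star Z * q = 0 := by rw [← hze, mul_assoc, heq, mul_zero]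
  have hZn : Z * n = 0 := by rw [← hn.left_mul_inv, ← mul_assoc, hzr, zero_mul]
  have hnZ : n * star Z = 0 := by rw [← hn.inv_mul_right, mul_assoc, hrz', mul_zero]
  have hqQ : q * Q = Q := by rw [hQ, mul_smul_comm, qq]
  have hQq : Q * q = Q := by rw [hQ, smul_mul_assoc, qq]
  have hqQ' : q * Q' = Q' := by rw [hQ', mul_smul_comm, qq]
  have hQq' : Q' * q = Q' := by rw [hQ', smul_mul_assoc, qq]
  have hQQ : Q * Q' = q := by
    rw [hQ, hQ', smul_mul_smul_comm, mul_inv_cancel₀ hκ.ne', qq, one_smul]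
  have hQQ' : Q' * Q = q := by
    rw [hQ, hQ', smul_mul_smul_comm, inv_mul_cancel₀ hκ.ne', qq, one_smul]
  have hrQ : r * Q = 0 := by rw [← hqQ, ← mul_assoc, hrq, zero_mul]
  have heQ : e * Q = 0 := by rw [← hqQ, ← mul_assoc, heq, zero_mul]
  have hQr : Q * r = 0 := by rw [← hQq, mul_assoc, hqr, mul_zero]
  have hQe : Q * e = 0 := by rw [← hQq, mul_assoc, hqe, mul_zero]
  have hrQ' : r * Q' = 0 := by rw [← hqQ', ← mul_assoc, hrq, zero_mul]
  have hQr' : Q' * r = 0 := by rw [← hQq', mul_assoc, hqr, mul_zero]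
  have hdQ' : d * Q' = 0 := by rw [← hqQ', ← mul_assoc, hdq, zero_mul]
  have hQd' : Q' * d = 0 := by rw [← hQq', mul_assoc, hqd, mul_zero]
  have hnQ : n * Q = 0 := by rw [← hqQ, ← mul_assoc, hnq, zero_mul]
  have hQn : Q * n = 0 := by rw [← hQq, mul_assoc, hqn, mul_zero]
  have hQsa : star Q = Q := by rw [hQ, star_smul, sq, star_trivial]
  set M := a + (d - r * a * r) + Q + (Z + star Z) with hM
  have hMsa : IsSelfAdjoint M := by
    rw [IsSelfAdjoint, hM]
    simp only [star_add, star_sub, star_mul, star_star, sr, sa, hd.star_eq, hQsa, mul_assoc]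
    rw [add_comm (star Z)]
  have hMN : (1 - e) * M * (1 - e) = d + Q := by
    have h1 : r * M = r * a + d - r * a * r := by
      simp only [hM, mul_add, mul_sub, ← mul_assoc, rr, hn.left_mul, hrQ, hrz, hrz']
      abel
    have h2 : q * M = Q + star Z := by
      simp only [hM, mul_add, mul_sub, ← mul_assoc, hqa, hqd, hqr, hqQ, hqz, hqz', zero_mul]
      abel
    rw [hsum, add_mul r q M, h1, h2]
    simp only [mul_add, add_mul, sub_mul, mul_assoc, haq, rr, hrq, hn.mul_right, hdq, hQr, hQq,
      hzr', hzq', mul_zero]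
    abel
  have hMe : M * e = a * e + star Z := by
    simp only [hM, add_mul, sub_mul, mul_assoc, hde, hre, hQe, hze', hze, mul_zero]
    abel
  have heM : e * M = e * a + Z := by
    simp only [hM, mul_add, mul_sub, ← mul_assoc, hed, her, heQ, heZ, hez', zero_mul]
    abel
  have hMY : (1 - e) * M * e = r * a * e + star Z := by
    rw [mul_assoc, hMe, hsum]
    simp only [add_mul, mul_add, ← mul_assoc, hqa, hrz', hqz, zero_mul]
    abel
  have hMX : e * M * (1 - e) = e * a * r + Z := by
    rw [heM, hsum]
    simp only [add_mul, mul_add, mul_assoc, haq, hzr, hZq, mul_zero]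
    abel
  have hMW : e * M * e = e * a * e := by
    rw [heM, add_mul, hze', add_zero]
  have hninv : IsCornerInverse (1 - e) ((1 - e) * M * (1 - e)) (n + Q') := by
    rw [hMN, hsum]
    refine ⟨?_, ?_, ?_, ?_, ?_, ?_⟩ <;>
    simp [mul_add, add_mul, hn.left_mul, hn.mul_right, hn.left_mul_inv, hn.inv_mul_right,
      hn.mul_inv, hn.inv_mul, hrQ, hQr, hrQ', hQr', hdQ', hQd', hdq, hqd, hnQ, hQn, hnq, hqn,
      hqQ, hQq, hqQ', hQq', hQQ, hQQ']
  have hS : e * M * e - e * M * (1 - e) * (n + Q') * ((1 - e) * M * e) =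
      w - (κ⁻¹ * τ ^ 2) • (z * star z) := by
    have h1 : Z * Q' * star Z = (κ⁻¹ * τ ^ 2) • (z * star z) := by
      rw [hZ, hQ', star_smul, star_trivial, smul_mul_smul_comm, smul_mul_smul_comm, hzq]
      congr 1
      ring
    have h2 : (e * a * r + Z) * (n + Q') = e * a * r * n + Z * Q' := by
      simp only [add_mul, mul_add, mul_assoc (e * a), hrQ', hZn, mul_zero]
      abel
    have h3 : (e * a * r * n + Z * Q') * (r * a * e + star Z) =
        e * a * r * n * (r * a * e) + Z * Q' * star Z := by
      have h4 : e * a * r * n * star Z = 0 := by rw [mul_assoc, hnZ, mul_zero]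
      have h5 : Z * Q' * (r * a * e) = 0 := by
        rw [mul_assoc r, ← mul_assoc _ r, mul_assoc Z, hQr']; simp
      rw [add_mul, mul_add, mul_add, h4, h5, add_zero, zero_add]
    rw [hMW, hMX, hMY, h2, h3, h1, hw]
    abel
  refine ⟨M, hMsa, ?_, ?_⟩
  · rw [isUnit_iff_isUnit_schur ee hninv, hS]
    set S := w - (κ⁻¹ * τ ^ 2) • (z * star z) with hSdef
    have heS : e * S = S := by
      rw [hSdef, mul_sub, mul_smul_comm, ← mul_assoc e z, hez]
      nth_rewrite 1 [← hew]
      rw [← mul_assoc, ← mul_assoc, ee, hew]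
    have hSle : S ≤ -e := by
      have h1 : w ≤ ‖w‖ • e := by
        have := he.isSelfAdjoint.conjugate_le_conjugate hwsa.le_algebraMap_norm_self
        rwa [hew, Algebra.algebraMap_eq_smul_one, mul_smul_comm, smul_mul_assoc, mul_one, ee]
          at this
      have h2 : (κ⁻¹ * τ ^ 2) • (l • e) ≤ (κ⁻¹ * τ ^ 2) • (z * star z) :=
        smul_le_smul_of_nonneg_left hz (by positivity)
      have h3 : (‖w‖ + 1) • e ≤ (κ⁻¹ * τ ^ 2 * l) • e :=
        smul_le_smul_of_nonneg_right hκw he.nonneg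
      rw [smul_smul] at h2
      rw [hSdef]
      calc w - (κ⁻¹ * τ ^ 2) • (z * star z) ≤ ‖w‖ • e - (‖w‖ + 1) • e :=
            sub_le_sub h1 (h3.trans h2)
        _ = -e := by rw [add_smul, one_smul]; abel
    have hT : IsUnit ((1 - e) - S) := by
      refine CStarAlgebra.isUnit_of_le 1 ?_ isStrictlyPositive_one
      calc (1 : A) = (1 - e) - -e := by abel
        _ ≤ (1 - e) - S := sub_le_sub_left hSle _
    have hV : IsUnit ((1 - e) - e) :=
      isUnit_iff_exists.mpr ⟨(1 - e) - e, by simp [mul_sub, sub_mul, ee],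
        by simp [mul_sub, sub_mul, ee]⟩
    refine hninv.isUnit_add he.one_sub.isIdempotentElem ?_ ?_
    · rw [sub_mul, heS, one_mul, sub_self]
    · have : (1 - e) + S = ((1 - e) - e) * ((1 - e) - S) := by
        simp only [mul_sub, sub_mul, one_mul, mul_one, ee, heS]
        abel
      rw [this]
      exact hV.mul hT
  · have h1 : M - a = (d - r * a * r) + (Q + (Z + star Z)) := by rw [hM]; abel
    have h2 : ‖Q‖ ≤ ε / 2 := by
      rw [hQ, norm_smul, Real.norm_of_nonneg hκ.le]
      exact (mul_le_of_le_one_right hκ.le hq.norm_le).trans hκε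
    have h3 : ‖Z + star Z‖ ≤ ε / 2 := by
      refine (norm_add_le _ _).trans (le_trans (le_of_eq ?_) hτz)
      rw [norm_star, hZ, norm_smul, Real.norm_of_nonneg hτ.le]
      ring
    rw [h1]
    refine (norm_add_le _ _).trans ?_
    gcongr
    linarith [norm_add_le Q (Z + star Z)]

end Approx

section CentrallyLarge

variable {A : Type*} [CStarAlgebra A]

/-! ### Cutting down to an annihilating projection -/

/-- Functional calculus flattens `a` to zero near the spectral value `0`; the annihilating element is
a bump function of `a` supported there, whose norm is attained at `0`. -/
theorem exists_near_annihilated {a : A} [PartialOrder A] [StarOrderedRing A]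
    (ha : IsSelfAdjoint a) (hau : ¬ IsUnit a) {ε : ℝ} (hε : 0 < ε) :
    ∃ a' b : A, IsSelfAdjoint a' ∧ 0 ≤ b ∧ ‖b‖ = 1 ∧ b * a' = 0 ∧ ‖a' - a‖ ≤ ε := by
  have h0 : (0 : ℝ) ∈ spectrum ℝ a := by
    by_contra h
    exact hau ((spectrum.zero_notMem_iff ℝ).mp h)
  set f : ℝ → ℝ := fun x => max (x - ε) 0 + min (x + ε) 0 with hf
  set u : ℝ → ℝ := fun x => max (1 - |x| / ε) 0 with hu
  have hfc : Continuous f := by fun_prop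
  have huc : Continuous u := by fun_prop
  refine ⟨cfc f a, cfc u a, cfc_predicate f a, cfc_nonneg fun x _ => le_max_right _ _, ?_, ?_, ?_⟩
  · refine le_antisymm (norm_cfc_le zero_le_one fun x _ => ?_) ?_
    · rw [Real.norm_of_nonneg (le_max_right _ _)]
      have : 0 ≤ |x| / ε := by positivity
      exact max_le (by linarith) zero_le_one
    · have := norm_apply_le_norm_cfc u a h0 huc.continuousOn ha
      simpa [hu] using this
  · rw [← cfc_mul u f a huc.continuousOn hfc.continuousOn]
    have : (fun x => u x * f x) = fun _ => 0 := by
      funext x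
      rcases le_or_gt ε |x| with h | h
      · have : u x = 0 := max_eq_right (by rw [sub_nonpos, one_le_div hε]; exact h)
        rw [this, zero_mul]
      · rw [abs_lt] at h
        have : f x = 0 := by
          simp only [hf]
          rw [max_eq_right (by linarith), min_eq_right (by linarith), add_zero]
        rw [this, mul_zero]
    rw [this, cfc_const_zero]
  · have : cfc f a - a = cfc (fun x => f x - x) a := by
      rw [cfc_sub f (fun x => x) a hfc.continuousOn continuousOn_id, cfc_id' ℝ a]
    rw [this]
    refine norm_cfc_le hε.le fun x _ => ?_
    simp only [hf]
    rw [Real.norm_eq_abs, abs_le]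
    rcases max_cases (x - ε) 0 with h | h <;> rcases min_cases (x + ε) 0 with h' | h' <;>
      constructor <;> linarith

theorem StarSubalgebra.exists_isSelfAdjoint_near {B : StarSubalgebra ℂ A} {x b : A} (hb : b ∈ B)
    (hx : IsSelfAdjoint x) {t : ℝ} (h : ‖b - x‖ ≤ t) :
    ∃ d ∈ B, IsSelfAdjoint d ∧ ‖d - x‖ ≤ t := by
  refine ⟨(1 / 2 : ℂ) • (b + star b), B.smul_mem (add_mem hb (star_mem hb) : b + star b ∈ B) _,
    ?_, ?_⟩
  · rw [IsSelfAdjoint, star_smul, star_add, star_star, add_comm]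
    simp
  · have h1 : (1 / 2 : ℂ) • (b + star b) - x = (1 / 2 : ℂ) • ((b - x) + star (b - x)) := by
      rw [star_sub, hx.star_eq, show b - x + (star b - x) = (b + star b) - (2 : ℂ) • x by
        rw [two_smul]; abel, smul_sub, smul_smul]
      norm_num
    have h2 : ‖(b - x) + star (b - x)‖ ≤ t + t :=
      (norm_add_le _ _).trans (by rw [norm_star]; gcongr)
    rw [h1, norm_smul, show ‖(1 / 2 : ℂ)‖ = 1 / 2 by norm_num]
    linarith

variable [PartialOrder A] [StarOrderedRing A]

/-- The element `b₀` of `B` approximating `(1 - g) * b * (1 - g)` has norm near `1` and almost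
annihilates `a`. The projection is the spectral projection of `b₀` above the level `1 / 2`: it is
nonzero by the norm condition on `g`, and dominated by `4 * b₀ ^ 2` up to a small error. -/
theorem IsCentrallyLarge.exists_projection_norm_mul_lt {B : StarSubalgebra ℂ A}
    (hB : IsCentrallyLarge B) (hRR : RealRankZero B) {a b : A} (hb : 0 ≤ b)
    (hb1 : ‖b‖ = 1) (hba : b * a = 0) {ε : ℝ} (hε : 0 < ε) :
    ∃ q ∈ B, IsStarProjection q ∧ q ≠ 0 ∧ ‖q * a‖ < ε := by
  have : Nontrivial A := ⟨b, 0, fun h => by simp [h] at hb1⟩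
  obtain ⟨η, hη, hη8, hηε⟩ : ∃ η : ℝ, 0 < η ∧ η ≤ 1 / 8 ∧ 2 * (η + 2 * η * ‖a‖) < ε := by
    refine ⟨min (1 / 8) (ε / (4 * (1 + 2 * ‖a‖))), by positivity, min_le_left _ _, ?_⟩
    have h1 : min (1 / 8) (ε / (4 * (1 + 2 * ‖a‖))) * (4 * (1 + 2 * ‖a‖)) ≤ ε := by
      rw [← le_div_iff₀ (by positivity)]
      exact min_le_right _ _
    linarith
  obtain ⟨c, g, ⟨hg0, hg1⟩, hc, hcB, -, hgb, hga⟩ := hB.exists_approx 2 two_pos ![a, b] η hη b hb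
    hb1 1 zero_le_one (by
      intro h
      exact one_ne_zero (congrArg Subtype.val h : (1 : A) = 0))
  have hgaa : ‖(g : A) * a - a * g‖ < η := hga 0
  have hcb : ‖c 1 - b‖ < η := hc 1
  have hcB1 := hcB 1
  set G := 1 - (g : A) with hG
  have hG0 : 0 ≤ G := sub_nonneg.mpr hg1
  have hGsa : IsSelfAdjoint G := .of_nonneg hG0
  have hG1 : ‖G‖ ≤ 1 :=
    (CStarAlgebra.norm_le_one_iff_of_nonneg G hG0).mpr (sub_le_self _ hg0)
  have hGB : G ∈ B := B.sub_mem B.one_mem g.2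
  have hGbG : 0 ≤ G * b * G := hGsa.conjugate_nonneg hb
  obtain ⟨b₀, hb₀B, hb₀, hb₀G⟩ := StarSubalgebra.exists_isSelfAdjoint_near
    (B.mul_mem hcB1 hGB) (IsSelfAdjoint.of_nonneg hGbG) (t := η) (by
      rw [← sub_mul, ← mul_sub]
      calc ‖G * (c 1 - b) * G‖ ≤ ‖G‖ * ‖c 1 - b‖ * ‖G‖ := norm_mul₃_le
        _ ≤ 1 * η * 1 := by gcongr
        _ = η := by ring)
  obtain ⟨q, hqB, k, -, hq, -, -, hk, hkd, -, -, hqk, hqk0, h1qk⟩ :=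
    hRR.exists_spectral_projection hB.isClosed (IsStarProjection.one A) B.one_mem hb₀ hb₀B
      (one_mul _) (1 / 2) hη
  refine ⟨q, hqB, hq, ?_, ?_⟩
  · rintro rfl
    rw [sub_zero, one_mul] at h1qk
    have h1 : G * b * G ≤ b₀ + η • (1 : A) :=
      (IsSelfAdjoint.of_nonneg hGbG).le_add_smul_one hb₀ (by rwa [norm_sub_rev])
    have h2 : b₀ - (1 / 2 : ℝ) • (1 : A) ≤ k + η • (1 : A) :=
      (hb₀.sub ((IsSelfAdjoint.all _).smul (.one A))).le_add_smul_one hk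
        (by rw [norm_sub_rev]; exact hkd.le)
    have h3 : G * b * G ≤ algebraMap ℝ A (1 / 2 + 2 * η) := by
      rw [Algebra.algebraMap_eq_smul_one]
      calc G * b * G ≤ (b₀ - (1 / 2 : ℝ) • (1 : A)) + (1 / 2 + η) • (1 : A) := by
            rw [add_smul]; convert! h1 using 1; abel
        _ ≤ (0 + η • (1 : A)) + (1 / 2 + η) • (1 : A) := by
            gcongr
            exact h2.trans (by gcongr)
        _ = (1 / 2 + 2 * η) • (1 : A) := by
            rw [zero_add, ← add_smul]; congr 1; ring
    have h4 := (CStarAlgebra.norm_le_iff_le_algebraMap (G * b * G) (by positivity) hGbG).mpr h3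
    linarith
  · set D := k + k + 1 with hD
    have hDsa : IsSelfAdjoint D := (hk.add hk).add (.one A)
    have hqq : q * q = q := hq.isIdempotentElem
    have hle : q ≤ D * D := by
      set w := q * k with hw
      have hwsa : star w = w := by
        rw [hw, star_mul, hk.star_eq, hq.isSelfAdjoint.star_eq]
        exact hqk.symm
      have hwq : w * q = w := by rw [hw, mul_assoc, ← hqk, ← mul_assoc, hqq]
      have hqw : q * w = w := by rw [hw, ← mul_assoc, hqq]
      have hqD : q * D = w + w + q := by rw [hD, mul_add, mul_add, mul_one]
      have hDq : D * q = w + w + q := by rw [hD, add_mul, add_mul, one_mul, ← hqk]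
      have h1 : 0 ≤ ((1 - q) * D) * star ((1 - q) * D) := mul_star_self_nonneg _
      have h2 : 0 ≤ w * w := by
        nth_rewrite 2 [← hwsa]
        exact mul_star_self_nonneg _
      have h3 : D * D - q = ((1 - q) * D) * star ((1 - q) * D) + (4 • (w * w) + 4 • w) := by
        have h4 : D * D * q = (w + w + q) * (w + w + q) := by
          rw [mul_assoc, hDq]
          nth_rewrite 1 [← hqq]
          have h5 : w + w + q * q = q * (w + w + q) := by
            rw [mul_add, mul_add, hqw]
          rw [h5, ← mul_assoc, hDq]
        have h6 : q * D * D = (w + w + q) * (w + w + q) := by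
          have h5 : w + w + q = (w + w + q) * q := by
            rw [add_mul, add_mul, hwq, hqq]
          rw [hqD, h5, mul_assoc, hqD, ← h5]
        have h7 : (w + w + q) * (w + w + q) = 4 • (w * w) + 4 • w + q := by
          simp only [add_mul, mul_add, hwq, hqw, hqq]
          abel
        have h8 : q * D * (D * q) = (w + w + q) * (w + w + q) := by rw [hqD, hDq]
        have h9 : ((1 - q) * D) * star ((1 - q) * D) =
            D * D - D * D * q - q * D * D + q * D * (D * q) := by
          rw [star_mul, hDsa.star_eq, hq.one_sub.isSelfAdjoint.star_eq]
          noncomm_ring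
        rw [h9, h4, h6, h8, h7]
        abel
      rw [← sub_nonneg, h3]
      have h10 := nsmul_nonneg h2 4
      have h11 := nsmul_nonneg hqk0 4
      exact add_nonneg h1 (add_nonneg h10 h11)
    have hqa : ‖q * a‖ ≤ ‖D * a‖ := by
      have h1 : star a * q * a ≤ star a * (D * D) * a := star_left_conjugate_le_conjugate hle a
      have h2 : star a * q * a = star (q * a) * (q * a) := by
        rw [star_mul, hq.isSelfAdjoint.star_eq, mul_assoc, mul_assoc, ← mul_assoc q q, hqq]
      have h3 : star a * (D * D) * a = star (D * a) * (D * a) := by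
        rw [star_mul, hDsa.star_eq]; simp only [mul_assoc]
      rw [h2, h3] at h1
      have h4 := CStarAlgebra.norm_le_norm_of_nonneg_of_le (star_mul_self_nonneg _) h1
      rw [CStarRing.norm_star_mul_self, CStarRing.norm_star_mul_self] at h4
      exact (mul_self_le_mul_self_iff (norm_nonneg _) (norm_nonneg _)).mpr h4
    have hGa : ‖G * b * G * a‖ ≤ η := by
      have h1 : G * b * G * a = G * b * (a * g - g * a) := by
        rw [hG]
        simp only [mul_sub, sub_mul, mul_assoc, one_mul, mul_one, hba]
        simp only [← mul_assoc, hba]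
        simp
      rw [h1]
      calc ‖G * b * (a * g - g * a)‖ ≤ ‖G‖ * ‖b‖ * ‖a * g - g * a‖ := norm_mul₃_le
        _ ≤ 1 * 1 * η := by
          rw [hb1, norm_sub_rev (a * (g : A))]; gcongr
        _ = η := by ring
    set X := G * b * G * a + (b₀ - G * b * G) * a + (k - (b₀ - (1 / 2 : ℝ) • (1 : A))) * a with hX
    have hDa : D * a = X + X := by
      have h1 : (1 / 2 : ℝ) • (1 : A) + (1 / 2 : ℝ) • (1 : A) = 1 := by
        rw [← add_smul]; norm_num
      rw [hX, hD, ← add_mul, ← add_mul, ← add_mul]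
      congr 1
      nth_rewrite 1 [← h1]
      abel
    have h5 : ‖(b₀ - G * b * G) * a‖ ≤ η * ‖a‖ :=
      (norm_mul_le _ _).trans (by gcongr)
    have h6 : ‖(k - (b₀ - (1 / 2 : ℝ) • (1 : A))) * a‖ ≤ η * ‖a‖ :=
      (norm_mul_le _ _).trans (by gcongr)
    have h7 : ‖X‖ ≤ η + η * ‖a‖ + η * ‖a‖ := norm_add₃_le.trans (by gcongr)
    have h8 : ‖D * a‖ ≤ ‖X‖ + ‖X‖ := hDa ▸ norm_add_le X X
    linarith

end CentrallyLarge

section CentrallyLarge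

variable {A : Type*} [CStarAlgebra A] [PartialOrder A] [StarOrderedRing A]

/-! ### Elements annihilated by a projection of the subalgebra -/

theorem norm_mul_sq_le_norm_conj {r g : A} (hr : IsSelfAdjoint r) (hg0 : 0 ≤ g) (hg1 : g ≤ 1) :
    ‖r * g‖ ^ 2 ≤ ‖r * g * r‖ := by
  have hg : IsSelfAdjoint g := .of_nonneg hg0
  have h1g : 0 ≤ 1 - g := sub_nonneg.mpr hg1
  have hgg : g * g ≤ g := by
    have h1 := hg.conjugate_nonneg h1g
    have h2 := (IsSelfAdjoint.of_nonneg h1g).conjugate_nonneg hg0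
    have h3 : g - g * g = g * (1 - g) * g + (1 - g) * g * (1 - g) := by noncomm_ring
    rw [← sub_nonneg, h3]
    exact add_nonneg h1 h2
  have h4 : r * (g * g) * r ≤ r * g * r := hr.conjugate_le_conjugate hgg
  have h5 : r * (g * g) * r = (r * g) * star (r * g) := by
    rw [star_mul, hr.star_eq, hg.star_eq]; simp only [mul_assoc]
  rw [h5] at h4
  have h6 := CStarAlgebra.norm_le_norm_of_nonneg_of_le (mul_star_self_nonneg _) h4
  rwa [CStarRing.norm_self_mul_star, ← sq] at h6

/-- If a nonzero projection `q` of `B` annihilates `a`, choose `g` Cuntz below `q` and let `e` be a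
spectral projection of `(1 - q) * g * (1 - q)`. On the rest `r = 1 - q - e` of the unit `g` is
small, so the `r` corner of `a` is nearly in `B`, while `e` is Cuntz below `q`. -/
theorem IsCentrallyLarge.exists_isUnit_near_of_mul_eq_zero {B : StarSubalgebra ℂ A}
    (hB : IsCentrallyLarge B) (hRR : RealRankZero B) {a q : A} (ha : IsSelfAdjoint a)
    (hqB : q ∈ B) (hq : IsStarProjection q) (hq0 : q ≠ 0) (hqa : q * a = 0) {ε : ℝ}
    (hε : 0 < ε) :
    ∃ M : A, IsSelfAdjoint M ∧ IsUnit M ∧ ‖M - a‖ < ε := by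
  have : Nontrivial A := ⟨q, 0, hq0⟩
  set σ := ε / (8 * (‖a‖ + 1)) with hσdef
  have hσ : 0 < σ := by positivity
  have hσa : σ * (‖a‖ + 1) = ε / 8 := by
    rw [hσdef]; field_simp
  set δ := σ ^ 2 / 2 with hδdef
  have hδ : 0 < δ := by positivity
  obtain ⟨η, hη, hη1, hηε⟩ : ∃ η : ℝ, 0 < η ∧ η ≤ 1 ∧ η ≤ ε / 8 :=
    ⟨min 1 (ε / 8), by positivity, min_le_left _ _, min_le_right _ _⟩
  obtain ⟨c, g, ⟨hg0, hg1⟩, hc, hcB, ⟨⟨v, hv⟩, -⟩, -, -⟩ := hB.exists_approx 1 one_pos ![a] η hη 1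
    zero_le_one CStarRing.norm_one ⟨q, hqB⟩ hq.nonneg (fun h => hq0 (congrArg Subtype.val h))
  have hca : ‖c 0 - a‖ < η := hc 0
  have hcB0 := hcB 0
  obtain ⟨N, hN⟩ := (Metric.tendsto_atTop.mp hv) (δ / 4) (by positivity)
  have hvg : ‖(v N : A) * q * star (v N : A) - g‖ < δ / 4 := by
    have := hN N le_rfl
    rw [dist_eq_norm] at this
    exact this
  generalize (v N : A) = v at hvg
  have hgsa : IsSelfAdjoint (g : A) := .of_nonneg hg0
  have hp := hq.one_sub
  have hpB : 1 - q ∈ B := B.sub_mem B.one_mem hqB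
  have hqp : q * (1 - q) = 0 := hq.mul_one_sub_self
  set p := 1 - q with hpdef
  have hpp : p * p = p := hp.isIdempotentElem
  have hh : IsSelfAdjoint (p * g * p) := by
    have := hgsa.conjugate p
    rwa [hp.isSelfAdjoint.star_eq] at this
  obtain ⟨e, heB, k, -, he, hpe, hep, hk, hkd, hpk, hkp, hek, hek0, hpek⟩ :=
    hRR.exists_spectral_projection hB.isClosed hp hpB hh (B.mul_mem (B.mul_mem hpB g.2) hpB)
      (by rw [← mul_assoc, ← mul_assoc, hpp]) δ (t := δ / 2) (by positivity)
  have hee : e * e = e := he.isIdempotentElem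
  have hr : IsStarProjection (p - e) := he.sub_of_mul_eq_left hp hep
  have hrB : p - e ∈ B := B.sub_mem hpB heB
  have hrp : (p - e) * p = p - e := by rw [sub_mul, hpp, hep]
  have hpr : p * (p - e) = p - e := by rw [mul_sub, hpp, hpe]
  have her : e * (p - e) = 0 := by rw [mul_sub, hep, hee, sub_self]
  have heq : e * q = 0 := by
    have : e * p = e - e * q := by rw [hpdef, mul_sub, mul_one]
    rw [hep, eq_comm, sub_eq_self] at this
    exact this
  have hpq : p * q = 0 := hq.one_sub_mul_self
  have hrq : (p - e) * q = 0 := by rw [sub_mul, hpq, heq, sub_self]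
  have hsum : 1 - e = (p - e) + q := by rw [hpdef]; abel
  set r := p - e with hrdef
  have hrr : r * r = r := hr.isIdempotentElem
  have hrk : r * k = k * r := by rw [hrdef, sub_mul, mul_sub, hpk, hkp, hek]
  clear_value r
  have hkδ : IsSelfAdjoint (k + δ • p) := hk.add ((IsSelfAdjoint.all _).smul hp.isSelfAdjoint)
  have hdist : ‖p * g * p - (k + δ • p)‖ ≤ δ / 2 := by
    rw [norm_sub_rev, show k + δ • p - p * g * p = k - (p * g * p - δ • p) by abel]
    exact hkd.le
  -- `g` is small on the corner of `r`.
  have hrg : ‖r * g‖ ≤ σ := by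
    have h1 := hr.conj_le_conj_add_smul hh hkδ hdist
    have h2 : r * (p * g * p) * r = r * g * r := by
      simp only [mul_assoc, hpr]
      rw [← mul_assoc r p, hrp]
    have h3 : r * (k + δ • p) * r = r * k + δ • r := by
      rw [mul_add, add_mul, mul_smul_comm, smul_mul_assoc, hrp, hrr, mul_assoc, ← hrk, ← mul_assoc,
        hrr]
    rw [h2, h3] at h1
    have h4 : r * g * r ≤ (σ ^ 2) • r := by
      calc r * g * r ≤ r * k + δ • r + (δ / 2) • r := h1
        _ ≤ 0 + δ • r + δ • r := by
          gcongr
          · exact hr.nonneg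
          · linarith
        _ = (σ ^ 2) • r := by
          rw [zero_add, ← add_smul, hδdef, add_halves]
    have h5 := hr.norm_conj_le hg0 (by positivity) h4
    exact (sq_le_sq₀ (norm_nonneg _) hσ.le).mp
      ((norm_mul_sq_le_norm_conj hr.isSelfAdjoint hg0 hg1).trans h5)
  -- Hence the `r` corner of `a` is close to `B`.
  obtain ⟨d₁, hd₁B, hd₁, hd₁a⟩ := StarSubalgebra.exists_isSelfAdjoint_near (x := r * a * r)
    (B.mul_mem (B.mul_mem hrB hcB0) hrB) (by
      have := ha.conjugate r
      rwa [hr.isSelfAdjoint.star_eq] at this) (t := ε / 4) (by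
      have h1 : r * ((1 - g) * c 0) * r - r * a * r = r * (c 0 - a) * r - r * g * c 0 * r := by
        noncomm_ring
      have h2 : ‖c 0‖ ≤ ‖a‖ + 1 := by
        have := norm_add_le (c 0 - a) a
        rw [sub_add_cancel] at this
        linarith
      have h3 : ‖r * (c 0 - a) * r‖ ≤ 1 * η * 1 := by
        refine norm_mul₃_le.trans ?_
        gcongr
        exacts [hr.norm_le, hr.norm_le]
      have h4 : ‖r * g * c 0 * r‖ ≤ σ * (‖a‖ + 1) * 1 := by
        refine norm_mul₃_le.trans ?_
        gcongr
        exact hr.norm_le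
      rw [h1]
      linarith [norm_sub_le (r * (c 0 - a) * r) (r * g * c 0 * r)])
  have hd₂a : ‖r * d₁ * r - r * a * r‖ ≤ ε / 4 := by
    have h1 : r * d₁ * r - r * a * r = r * (d₁ - r * a * r) * r := by
      have h2 : r * (r * a * r) * r = r * a * r := by
        rw [← mul_assoc, ← mul_assoc, hrr, mul_assoc _ r r, hrr]
      rw [mul_sub, sub_mul, h2]
    rw [h1]
    refine norm_mul₃_le.trans ?_
    calc ‖r‖ * ‖d₁ - r * a * r‖ * ‖r‖ ≤ 1 * (ε / 4) * 1 := by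
          gcongr
          exacts [hr.norm_le, hr.norm_le]
      _ = ε / 4 := by ring
  obtain ⟨d, n, -, hd, hn, hdd⟩ := hRR.exists_corner_mem hB.isClosed hr hrB (d := r * d₁ * r) (by
      have := hd₁.conjugate r
      rwa [hr.isSelfAdjoint.star_eq] at this) (B.mul_mem (B.mul_mem hrB hd₁B) hrB)
    (by rw [← mul_assoc, ← mul_assoc, hrr]) (t := ε / 4) (by positivity)
  have hda : ‖d - r * a * r‖ < ε / 2 := by
    have := norm_add_le (d - r * d₁ * r) (r * d₁ * r - r * a * r)
    rw [sub_add_sub_cancel] at this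
    linarith
  -- The corner of `e` is reached from `q`.
  have hz : (δ / 4) • e ≤ (e * v * q) * star (e * v * q) := by
    have h1 := he.conj_le_conj_add_smul hkδ hh (t := δ / 2) (by rwa [norm_sub_rev])
    have h2 := he.conj_le_conj_add_smul (y := v * q * star v) hgsa (by
      rw [IsSelfAdjoint]
      simp only [star_mul, star_star, hq.isSelfAdjoint.star_eq, mul_assoc])
      (t := δ / 4) (by rw [norm_sub_rev]; exact hvg.le)
    have h3 : e * (p * g * p) * e = e * g * e := by
      rw [← mul_assoc, ← mul_assoc, hep, mul_assoc _ p e, hpe]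
    have h4 : e * (k + δ • p) * e = e * k + δ • e := by
      rw [mul_add, add_mul, mul_smul_comm, smul_mul_assoc, hep, hee, mul_assoc, ← hek, ← mul_assoc,
        hee]
    have h5 : (e * v * q) * star (e * v * q) = e * (v * q * star v) * e := by
      simp only [star_mul, he.isSelfAdjoint.star_eq, hq.isSelfAdjoint.star_eq, mul_assoc]
      rw [← mul_assoc q q, hq.isIdempotentElem.eq]
    rw [h3, h4] at h1
    rw [h5]
    have h6 : δ • e ≤ e * (v * q * star v) * e + (δ / 4) • e + (δ / 2) • e :=
      calc δ • e ≤ e * k + δ • e := le_add_of_nonneg_left hek0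
        _ ≤ e * g * e + (δ / 2) • e := h1
        _ ≤ _ := by gcongr
    have h7 : δ • e = (δ / 4) • e + (δ / 4) • e + (δ / 2) • e := by
      rw [← add_smul, ← add_smul]; congr 1; ring
    rw [h7] at h6
    simpa using h6
  obtain ⟨M, hM, hMu, hMa⟩ := exists_isUnit_near_of_corner he hr hq hsum her heq hrq ha hqa hd hn
    (z := e * v * q) (by rw [← mul_assoc, ← mul_assoc, hee])
    (by rw [mul_assoc, hq.isIdempotentElem.eq]) (by positivity) hz (ε := ε / 4) (by positivity)
  exact ⟨M, hM, hMu, by linarith⟩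

end CentrallyLarge

/-! ### Real rank zero -/

theorem theorem3p11 {A : Type*} [CStarAlgebra A] [PartialOrder A] [StarOrderedRing A]
    (hsimple : IsSimpleCStar A) (hinf : ¬ FiniteDimensional ℂ A)
    (B : StarSubalgebra ℂ A) (hB : IsCentrallyLarge B)
    (hRR : RealRankZero B) :
    RealRankZero A := by
  suffices H : ∀ a : A, IsSelfAdjoint a → ∀ ε : ℝ, 0 < ε →
      ∃ M : A, IsSelfAdjoint M ∧ IsUnit M ∧ ‖M - a‖ < ε by
    refine Metric.dense_iff.mpr fun a ε hε => ?_
    obtain ⟨M, hM, hMu, hMa⟩ := H a a.2 ε hε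
    refine ⟨⟨M, hM⟩, ?_, hMu⟩
    rw [Metric.mem_ball, Subtype.dist_eq, dist_eq_norm]
    exact hMa
  intro a ha ε hε
  by_cases hau : IsUnit a
  · exact ⟨a, ha, hau, by simpa using hε⟩
  obtain ⟨a₁, b, ha₁, hb, hb1, hba, ha₁a⟩ := exists_near_annihilated ha hau (ε := ε / 4)
    (by positivity)
  obtain ⟨q, hqB, hq, hq0, hqa⟩ := hB.exists_projection_norm_mul_lt hRR hb hb1 hba
    (ε := ε / 8) (by positivity)
  have hp := hq.one_sub
  set p := 1 - q with hpdef
  have hqp : q * p = 0 := hq.mul_one_sub_self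
  obtain ⟨M, hM, hMu, hMa⟩ := hB.exists_isUnit_near_of_mul_eq_zero hRR (a := p * a₁ * p) (by
      have := ha₁.conjugate p
      rwa [hp.isSelfAdjoint.star_eq] at this) hqB hq hq0
    (by rw [← mul_assoc, ← mul_assoc, hqp, zero_mul, zero_mul]) (ε := ε / 4) (by positivity)
  refine ⟨M, hM, hMu, ?_⟩
  have h1 : p * a₁ * p - a₁ = -(q * a₁ + p * star (q * a₁)) := by
    rw [star_mul, ha₁.star_eq, hq.isSelfAdjoint.star_eq, hpdef]
    noncomm_ring
  have h2 : ‖p * star (q * a₁)‖ ≤ ‖q * a₁‖ := by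
    refine (norm_mul_le _ _).trans ?_
    rw [norm_star]
    exact mul_le_of_le_one_left (norm_nonneg _) hp.norm_le
  have h3 : ‖p * a₁ * p - a₁‖ ≤ ‖q * a₁‖ + ‖q * a₁‖ := by
    rw [h1, norm_neg]
    exact (norm_add_le _ _).trans (by gcongr)
  have h4 : M - a = (M - p * a₁ * p) + (p * a₁ * p - a₁) + (a₁ - a) := by abel
  rw [h4]
  linarith [norm_add₃_le (a := M - p * a₁ * p) (b := p * a₁ * p - a₁) (c := a₁ - a)]
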